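/- Let $X$ be a reflexive real Banach space with dual $X^*$, let $C\subseteq X$ be nonempty, and let $F,G:C\times C\to\mathbb{R}$ satisfy $F(x,x)=G(x,x)=0$ for all $x\in C$. A function $H:C\times C\to\mathbb{R}$ is called monotone if $H(x,y)+H(y,x)\le 0$ for all $x,y\in C$. With $H$ one associates the operator $A^H:X\rightrightarrows X^*$, where $A^H(x)=\{x^*\in X^*: H(x,y)-H(x,x)\ge\langle x^*,y-x\rangle\ \forall y\in C\}$ if $x\in C$ and $A^H(x)=\emptyset$ otherwise; $H$ is called maximal monotone if it is monotone and $A^H$ is a maximal monotone operator. Write $D(T)=\{x: T(x)\ne\emptyset\}$ for the domain of an operator $T:X\rightrightarrows X^*$. A representative function of a monotone operator $T:X\rightrightarrows X^*$ is a convex, norm lower semicontinuous function $h:X\times X^*\to\overline{\mathbb{R}}$ with $h(x,x^*)\ge\langle x^*,x\rangle$ for all $(x,x^*)\in X\times X^*$ and $h(x,x^*)=\langle x^*,x\rangle$ whenever $x^*\in T(x)$. For $U\subseteq X$ let $\mathrm{sqri}(U)$ be the set of all $x\in U$ such that $\mathrm{cone}(U-x)=\{t(u-x): t\ge 0,\ u\in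 U\}$ is a closed linear subspace of $X$. For $f,g:X\times X^*\to(-\infty,+\infty]$ put $(f\square_2 g)(x,x^*)=\inf\{f(x,u^*)+g(x,x^*-u^*): u^*\in X^*\}$. Let $\mathrm{dom} f=\{f<+\infty\}$ and let $\mathrm{pr}_X:X\times X^*\to X$ be the projection. Suppose that $F$ and $G$ are maximal monotone, and let $f_F$ and $f_G$ be representative functions of $A^F$ and $A^G$, respectively. Then $$0\in\mathrm{sqri}\big(D(A^F)-D(A^G)\big)\iff 0\in\mathrm{sqri}\big(\mathrm{pr}_X(\mathrm{dom} f_F)-\mathrm{pr}_X(\mathrm{dom} f_G)\big),$$ and if these equivalent conditions hold, then $F+G$ is maximal monotone, $A^F(x)+A^G(x)=A^{F+G}(x)$ for all $x\in X$, and $f_F\square_2 f_G$ is a representative function of $A^{F+G}$. -/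

import Mathlib

open scoped Pointwise

noncomputable section

/-- A normed space is reflexive if the canonical map into its bidual is onto. -/
def IsReflexiveSpace (X : Type*) [NormedAddCommGroup X] [NormedSpace ℝ X] : Prop :=
  Function.Surjective (NormedSpace.inclusionInDoubleDual ℝ X)

/-- The conical hull `{t u : t ≥ 0, u ∈ U}`. -/
def coneOf {X : Type*} [AddCommGroup X] [Module ℝ X] (U : Set X) : Set X :=
  {y | ∃ t : ℝ, 0 ≤ t ∧ ∃ u ∈ U, y = t • u}

/-- The strong quasi relative interior: points `x` of `U` for which the conical hull of `U - x`
is a closed linear subspace. -/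
def sqri {X : Type*} [NormedAddCommGroup X] [NormedSpace ℝ X] (U : Set X) : Set X :=
  {x | x ∈ U ∧ ∃ Y : Submodule ℝ X, IsClosed (Y : Set X) ∧
    coneOf ((fun u => u - x) '' U) = (Y : Set X)}

/-- The effective domain of an extended real valued function. -/
def effDom {E : Type*} (f : E → EReal) : Set E := {p | f p < ⊤}

/-- Convexity of an extended real valued function, as convexity of its epigraph. -/
def IsConvexFun {E : Type*} [AddCommGroup E] [Module ℝ E] (f : E → EReal) : Prop :=
  Convex ℝ {p : E × ℝ | f p.1 ≤ (p.2 : EReal)}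

/-- Partial infimal convolution `(f □₂ g)(a, b) = inf {f (a, c) + g (a, b - c) : c ∈ B}`. It is
used only for functions that never take the value `-∞`. -/
def infConvSnd {A B : Type*} [AddCommGroup B] (f g : A × B → EReal) : A × B → EReal :=
  fun p => ⨅ c : B, f (p.1, c) + g (p.1, p.2 - c)

section Operators

variable {X : Type*} [NormedAddCommGroup X] [NormedSpace ℝ X]

/-- Monotonicity of a multifunction from `X` to its dual. -/
def IsMonotoneOp (T : X → Set (StrongDual ℝ X)) : Prop :=
  ∀ x y : X, ∀ x' ∈ T x, ∀ y' ∈ T y, 0 ≤ (y' - x') (y - x)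

/-- Maximality: the graph is not properly contained in the graph of a monotone operator. -/
def IsMaximalMonotoneOp (T : X → Set (StrongDual ℝ X)) : Prop :=
  IsMonotoneOp T ∧
    ∀ S : X → Set (StrongDual ℝ X), IsMonotoneOp S → (∀ x, T x ⊆ S x) → S = T

/-- The domain `D(T)`. -/
def opDom (T : X → Set (StrongDual ℝ X)) : Set X := {x | (T x).Nonempty}

/-- `h` is a representative function of the monotone operator `T`: it is convex and lower
semicontinuous for the norm topology of `X × X*`, it majorizes the coupling function
`c (x, x*) = ⟨x*, x⟩` and it agrees with `c` on the graph of `T`. -/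
structure IsRepresentative (h : X × StrongDual ℝ X → EReal)
    (T : X → Set (StrongDual ℝ X)) : Prop where
  monotone : IsMonotoneOp T
  convex : IsConvexFun h
  lsc : LowerSemicontinuous h
  coupling_le : ∀ (x : X) (x' : StrongDual ℝ X), ((x' x : ℝ) : EReal) ≤ h (x, x')
  eq_coupling : ∀ (x : X), ∀ x' ∈ T x, h (x, x') = ((x' x : ℝ) : EReal)

/-- Monotonicity of a bifunction on `C`. -/
def IsMonotoneBif {C : Set X} (F : C → C → ℝ) : Prop :=
  ∀ x y : C, F x y + F y x ≤ 0

/-- The operator `A^F`: `x* ∈ A^F(x)` iff `x ∈ C` and `F(x, y) - F(x, x) ≥ ⟨x*, y - x⟩` for all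
`y ∈ C`. -/
def bifOp {C : Set X} (F : C → C → ℝ) : X → Set (StrongDual ℝ X) :=
  fun x => {x' | ∃ hx : x ∈ C, ∀ y : C, x' ((y : X) - x) ≤ F ⟨x, hx⟩ y - F ⟨x, hx⟩ ⟨x, hx⟩}

/-- A monotone bifunction `F` is maximal monotone if `A^F` is a maximal monotone operator. -/
def IsMaximalMonotoneBif {C : Set X} (F : C → C → ℝ) : Prop :=
  IsMonotoneBif F ∧ IsMaximalMonotoneOp (bifOp F)

end Operators

end

/-!
The Fitzpatrick function `φ_T` of a maximal monotone operator `T` lies below every representative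
function `f` of `T`, because `f` is convex, lies above the coupling and touches it on the graph of
`T`. Hence `D(T) ⊆ pr_X (dom f) ⊆ pr_X (dom φ_T)`.

If `0 ∈ sqri (pr_X (dom φ_S) - pr_X (dom φ_T))`, then the infimal convolution of the conjugates
`φ_S*` and `φ_T*` is exact and lower semicontinuous: the linear forms that occur in a convergent
sequence matter only on the difference of the domains, where Banach-Steinhaus bounds them, so that
weak-star compactness applies. Consequently the conjugate of `φ_S □₂ φ_T` is `φ_S* □₂ φ_T*`. For
every `(z, z')`, the convex function `φ_S □₂ φ_T` lies above the coupling, which in turn lies above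
the concave function `u x - fenchelYoungGap (x - z) (u - z')` of `(x, u)`. Separating the two
functions by an affine one yields a point of the graph of `S + T` at which the gap vanishes, and
this forces maximality of `S + T`.

The same construction applied to `S` and `x ↦ T (x - w)` shows that every `w` in
`sqri (pr_X (dom φ_S) - pr_X (dom φ_T))` lies in `D(S) - D(T)`. As any closed subspace containing
`D(S) - D(T)` also contains `pr_X (dom φ_S) - pr_X (dom φ_T)`, the qualification condition does not
change when `D(S)` and `D(T)` are enlarged within `pr_X (dom φ_S)` and `pr_X (dom φ_T)`. For
representative functions `f` and `g`, the domains of `f*` and `g*` are such enlargements, so that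
`f □₂ g = (f*)* □₂ (g*)*` is exact and lower semicontinuous too.
-/

open Filter Topology

section Separation

variable {V : Type*} [AddCommGroup V] [Module ℝ V] [TopologicalSpace V]

theorem apply_mk_eq_apply_zero_add_mul (L : StrongDual ℝ (V × ℝ)) (v : V) (r : ℝ) :
    L (v, r) = L (v, 0) + r * L (0, 1) := by
  rw [← smul_eq_mul, ← map_smul, ← map_add]
  simp

variable [IsTopologicalAddGroup V] [ContinuousSMul ℝ V]

theorem exists_affine_between_of_concaveOn {g : V → ℝ} (hg : ConcaveOn ℝ Set.univ g)
    (hgc : Continuous g) {H : Set (V × ℝ)} (hH : Convex ℝ H) (hne : H.Nonempty)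
    (hle : ∀ v r, (v, r) ∈ H → g v ≤ r) :
    ∃ (f : StrongDual ℝ V) (c : ℝ),
      (∀ v, g v ≤ f v + c) ∧ ∀ v r, (v, r) ∈ H → f v + c ≤ r := by
  let B : Set (V × ℝ) := {p | p.1 ∈ Set.univ ∧ p.2 < g p.1}
  have hBo : IsOpen B := by
    simpa only [B, Set.mem_univ, true_and, Function.comp_apply] using
      isOpen_lt continuous_snd (hgc.comp continuous_fst)
  have hdisj : Disjoint B H :=
    Set.disjoint_left.2 fun p hpB hpH => (hle p.1 p.2 hpH).not_gt hpB.2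
  obtain ⟨L, t, hLB, hLH⟩ := geometric_hahn_banach_open hg.convex_strict_hypograph hBo hH hdisj
  replace hLB : ∀ v r, r < g v → L (v, 0) + r * L (0, 1) < t := fun v r h =>
    apply_mk_eq_apply_zero_add_mul L v r ▸ hLB (v, r) ⟨Set.mem_univ v, h⟩
  replace hLH : ∀ v r, (v, r) ∈ H → t ≤ L (v, 0) + r * L (0, 1) := fun v r h =>
    apply_mk_eq_apply_zero_add_mul L v r ▸ hLH (v, r) h
  set τ := L (0, 1)
  have hτ : 0 < τ := by
    obtain ⟨⟨v, r⟩, h⟩ := hne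
    have hbelow := hLB v (g v - 1) (sub_one_lt _)
    have habove := hLH v r h
    have hgap := hle v r h
    by_contra! hτ
    nlinarith
  refine ⟨-(τ⁻¹ • L.comp (.inl ℝ V ℝ)), τ⁻¹ * t, fun v => ?_, fun v r h => ?_⟩
  · refine le_of_forall_lt fun r hr => ?_
    have := mul_lt_mul_of_pos_left (hLB v r hr) (inv_pos.2 hτ)
    rw [mul_add, mul_comm r, inv_mul_cancel_left₀ hτ.ne'] at this
    simp only [neg_apply, smul_apply, smul_eq_mul, ContinuousLinearMap.comp_apply,
      ContinuousLinearMap.inl_apply]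
    linarith
  · have := mul_le_mul_of_nonneg_left (hLH v r h) (inv_pos.2 hτ).le
    rw [mul_add, mul_comm r, inv_mul_cancel_left₀ hτ.ne'] at this
    simp only [neg_apply, smul_apply, smul_eq_mul, ContinuousLinearMap.comp_apply,
      ContinuousLinearMap.inl_apply]
    linarith

theorem exists_affine_minorant_of_notMem [LocallyConvexSpace ℝ V] {E : Set (V × ℝ)}
    (hE : Convex ℝ E) (hcl : IsClosed E) (hup : ∀ ⦃v r s⦄, (v, r) ∈ E → r ≤ s → (v, s) ∈ E)
    {f₀ : StrongDual ℝ V} {c₀ : ℝ} (hf₀ : ∀ v r, (v, r) ∈ E → f₀ v + c₀ ≤ r)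
    {x : V} {y : ℝ} (hxy : (x, y) ∉ E) :
    ∃ (f : StrongDual ℝ V) (c : ℝ), (∀ v r, (v, r) ∈ E → f v + c ≤ r) ∧ y < f x + c := by
  rcases E.eq_empty_or_nonempty with rfl | ⟨⟨v₀, r₀⟩, h₀⟩
  · exact ⟨0, y + 1, fun _ _ h => h.elim, by simp⟩
  obtain ⟨L, t, hLE, hLx⟩ := geometric_hahn_banach_closed_point hE hcl hxy
  replace hLE : ∀ v r, (v, r) ∈ E → L (v, 0) + r * L (0, 1) < t := fun v r h =>
    apply_mk_eq_apply_zero_add_mul L v r ▸ hLE (v, r) h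
  rw [apply_mk_eq_apply_zero_add_mul] at hLx
  set τ := L (0, 1)
  have hτ : τ ≤ 0 := by
    by_contra! hτ
    set d := t - (L (v₀, 0) + r₀ * τ) with hd
    have hd0 : 0 < d := sub_pos.2 (hLE v₀ r₀ h₀)
    have := hLE v₀ (r₀ + d / τ) (hup h₀ (le_add_of_nonneg_right (by positivity)))
    rw [add_mul, div_mul_cancel₀ _ hτ.ne'] at this
    linarith [hd]
  -- The separating hyperplane may be vertical (`τ = 0`); adding the given minorant tilts it.
  obtain ⟨k, hk⟩ := exists_nat_gt ((y - (f₀ x + c₀)) / (L (x, 0) + y * τ - t))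
  rw [div_lt_iff₀ (sub_pos.2 hLx)] at hk
  have hμ : 0 < 1 - k * τ := by nlinarith [(Nat.cast_nonneg k : (0 : ℝ) ≤ k)]
  refine ⟨(1 - k * τ)⁻¹ • (f₀ + (k : ℝ) • L.comp (.inl ℝ V ℝ)), (1 - k * τ)⁻¹ * (c₀ - k * t),
    fun v r h => ?_, ?_⟩
  all_goals
    simp only [smul_apply, add_apply, smul_eq_mul, ContinuousLinearMap.comp_apply,
      ContinuousLinearMap.inl_apply, ← mul_add]
  · rw [inv_mul_le_iff₀ hμ]
    have := mul_le_mul_of_nonneg_left (hLE v r h).le (Nat.cast_nonneg (α := ℝ) k)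
    linarith [hf₀ v r h]
  · rw [lt_inv_mul_iff₀ hμ]
    linarith

theorem exists_forall_le_and_forall_le_sub {A B : Set ℝ} (hA : A.Nonempty) (hB : B.Nonempty)
    {t : ℝ} (h : ∀ a ∈ A, ∀ b ∈ B, a + b ≤ t) :
    ∃ s, (∀ a ∈ A, a ≤ s) ∧ ∀ b ∈ B, b ≤ t - s := by
  obtain ⟨b₀, hb₀⟩ := hB
  refine ⟨sSup A, fun a ha => le_csSup ⟨t - b₀, fun a ha => ?_⟩ ha, fun b hb => ?_⟩
  · linarith [h a ha b₀ hb₀]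
  · linarith [csSup_le hA fun a ha => le_sub_iff_add_le.2 (h a ha b hb)]

theorem exists_annihilator_apply_ne_zero {X : Type*} [NormedAddCommGroup X] [NormedSpace ℝ X]
    {Y : Submodule ℝ X} (hY : IsClosed (Y : Set X)) {x : X} (hx : x ∉ Y) :
    ∃ η : StrongDual ℝ X, (∀ y ∈ Y, η y = 0) ∧ η x ≠ 0 := by
  have : IsClosed (Y : Set X) := hY
  have hx' : Y.mkQ x ≠ 0 := by simpa using hx
  obtain ⟨f, hf⟩ := SeparatingDual.exists_ne_zero (R := ℝ) hx'
  exact ⟨f.comp Y.mkQL, fun y hy => by simp [(Submodule.Quotient.mk_eq_zero Y).2 hy], hf⟩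

end Separation

section Sqri

variable {X : Type*} [NormedAddCommGroup X] [NormedSpace ℝ X]

theorem mem_sqri_iff {U : Set X} {x : X} :
    x ∈ sqri U ↔ x ∈ U ∧ ∃ Y : Submodule ℝ X, IsClosed (Y : Set X) ∧ (∀ u ∈ U, u - x ∈ Y) ∧
      ∀ y ∈ Y, ∃ t : ℝ, 0 ≤ t ∧ ∃ u ∈ U, y = t • (u - x) := by
  simp only [sqri, Set.mem_ofPred_eq, Set.Subset.antisymm_iff]
  refine and_congr_right fun _ => exists_congr fun Y => and_congr_right fun _ =>
    and_congr ⟨fun h u hu => ?_, ?_⟩ ⟨fun h y hy => ?_, fun h y hy => ?_⟩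
  · exact h ⟨1, zero_le_one, u - x, ⟨u, hu, rfl⟩, (one_smul ℝ _).symm⟩
  · rintro h _ ⟨t, -, _, ⟨u, hu, rfl⟩, rfl⟩
    exact Y.smul_mem t (h u hu)
  · obtain ⟨t, ht, _, ⟨u, hu, rfl⟩, rfl⟩ := h hy
    exact ⟨t, ht, u, hu, rfl⟩
  · obtain ⟨t, ht, u, hu, rfl⟩ := h y hy
    exact ⟨t, ht, u - x, ⟨u, hu, rfl⟩, rfl⟩

theorem sqri_subset (U : Set X) : sqri U ⊆ U := fun _ hx => hx.1

theorem zero_mem_sqri_iff {U : Set X} :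
    0 ∈ sqri U ↔ 0 ∈ U ∧ ∃ Y : Submodule ℝ X, IsClosed (Y : Set X) ∧ U ⊆ Y ∧
      ∀ y ∈ Y, ∃ t : ℝ, 0 ≤ t ∧ ∃ u ∈ U, y = t • u := by
  simp only [mem_sqri_iff, sub_zero]
  rfl

theorem zero_mem_sqri_image_sub {U : Set X} {w : X} :
    0 ∈ sqri ((fun u => u - w) '' U) ↔ w ∈ sqri U := by
  simp [mem_sqri_iff, sub_eq_zero]

theorem zero_mem_sqri_of_subset {U V : Set X} (hUV : U ⊆ V)
    (hspan : ∀ Y : Submodule ℝ X, IsClosed (Y : Set X) → U ⊆ Y → V ⊆ Y) (h : 0 ∈ sqri U) :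
    0 ∈ sqri V := by
  obtain ⟨h0, Y, hY, hUY, hcone⟩ := zero_mem_sqri_iff.1 h
  refine zero_mem_sqri_iff.2 ⟨hUV h0, Y, hY, hspan Y hY hUY, fun y hy => ?_⟩
  obtain ⟨t, ht, u, hu, rfl⟩ := hcone y hy
  exact ⟨t, ht, u, hUV hu, rfl⟩

theorem half_smul_mem_sqri {K : Set X} (hK : Convex ℝ K) (h : 0 ∈ sqri K) {d : X} (hd : d ∈ K) :
    (1 / 2 : ℝ) • d ∈ sqri K := by
  obtain ⟨h0, Y, hY, hKY, hcone⟩ := zero_mem_sqri_iff.1 h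
  have hmid : ∀ {k}, k ∈ K → (1 / 2 : ℝ) • k + (1 / 2 : ℝ) • d ∈ K := fun hk =>
    hK hk hd (by norm_num) (by norm_num) (by norm_num)
  have hhalf : (1 / 2 : ℝ) • d ∈ K := by simpa using hmid h0
  refine mem_sqri_iff.2 ⟨hhalf, Y, hY, fun u hu => Y.sub_mem (hKY hu) (hKY hhalf), fun y hy => ?_⟩
  obtain ⟨t, ht, k, hk, rfl⟩ := hcone y hy
  exact ⟨2 * t, by positivity, _, hmid hk, by module⟩

theorem zero_mem_sqri_of_sqri_subset {K U : Set X} (hK : Convex ℝ K) (hsub : sqri K ⊆ U)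
    (hUK : U ⊆ K) (h : 0 ∈ sqri K) : 0 ∈ sqri U := by
  obtain ⟨-, Y, hY, hKY, hcone⟩ := zero_mem_sqri_iff.1 h
  refine zero_mem_sqri_iff.2 ⟨hsub h, Y, hY, hUK.trans hKY, fun y hy => ?_⟩
  obtain ⟨t, ht, d, hd, rfl⟩ := hcone y hy
  exact ⟨2 * t, by positivity, _, hsub (half_smul_mem_sqri hK h hd), by module⟩

end Sqri

section Conjugates

/-- The projection to `A` of the domain of the function on `A × B` with epigraph `E`. -/
def epiDom {A B : Type*} (E : Set ((A × B) × ℝ)) : Set A :=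
  {a | ∃ b r, ((a, b), r) ∈ E}

theorem epiDom_mono {A B : Type*} {E E' : Set ((A × B) × ℝ)} (h : E ⊆ E') :
    epiDom E ⊆ epiDom E' :=
  fun _ ⟨b, r, hb⟩ => ⟨b, r, h hb⟩

theorem convex_epiDom {A B : Type*} [AddCommGroup A] [Module ℝ A] [AddCommGroup B] [Module ℝ B]
    {E : Set ((A × B) × ℝ)} (hE : Convex ℝ E) : Convex ℝ (epiDom E) := by
  rintro a ⟨b, r, h⟩ a' ⟨b', r', h'⟩ s t hs ht hst
  exact ⟨s • b + t • b', s • r + t • r', hE h h' hs ht hst⟩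

/-- The epigraph of the function `(a, a', b) ↦ inf {f (a, u) + g (a', b - u) : u ∈ B}`, provided
the infimum is attained, where `E` and `E'` are the epigraphs of `f` and `g`. -/
def epiInfConv {A A' B : Type*} [Sub B] (E : Set ((A × B) × ℝ)) (E' : Set ((A' × B) × ℝ)) :
    Set ((A × A' × B) × ℝ) :=
  {p | ∃ u s, ((p.1.1, u), s) ∈ E ∧ ((p.1.2.1, p.1.2.2 - u), p.2 - s) ∈ E'}

/-- The epigraph of the partial infimal convolution `f □₂ g`, provided the infimum is attained,
where `E` and `E'` are the epigraphs of `f` and `g`: the restriction of `epiInfConv E E'` to the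
diagonal. -/
def epiInfConvSnd {A B : Type*} [Sub B] (E E' : Set ((A × B) × ℝ)) : Set ((A × B) × ℝ) :=
  {p | ((p.1.1, p.1.1, p.1.2), p.2) ∈ epiInfConv E E'}

theorem convex_epiInfConv {A A' B : Type*} [AddCommGroup A] [Module ℝ A] [AddCommGroup A']
    [Module ℝ A'] [AddCommGroup B] [Module ℝ B] {E : Set ((A × B) × ℝ)}
    {E' : Set ((A' × B) × ℝ)} (hE : Convex ℝ E) (hE' : Convex ℝ E') :
    Convex ℝ (epiInfConv E E') := by
  rintro ⟨⟨a, a', b⟩, r⟩ ⟨u, s, h₁, h₂⟩ ⟨⟨c, c', d⟩, r'⟩ ⟨v, t, h₃, h₄⟩ k l hk hl hkl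
  refine ⟨k • u + l • v, k • s + l • t, hE h₁ h₃ hk hl hkl, ?_⟩
  convert hE' h₂ h₄ hk hl hkl using 1
  ext1
  · ext1
    · rfl
    · change k • b + l • d - (k • u + l • v) = k • (b - u) + l • (d - v)
      module
  · change k • r + l • r' - (k • s + l • t) = k • (r - s) + l • (r' - t)
    module

theorem convex_epiInfConvSnd {A B : Type*} [AddCommGroup A] [Module ℝ A] [AddCommGroup B]
    [Module ℝ B] {E E' : Set ((A × B) × ℝ)} (hE : Convex ℝ E) (hE' : Convex ℝ E') :
    Convex ℝ (epiInfConvSnd E E') :=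
  fun _ hp _ hq _ _ ha hb hab => convex_epiInfConv hE hE' hp hq ha hb hab

theorem epiInfConvSnd_nonempty {A B : Type*} [AddGroup B] {E E' : Set ((A × B) × ℝ)} {a : A}
    (h : a ∈ epiDom E) (h' : a ∈ epiDom E') : (epiInfConvSnd E E').Nonempty := by
  obtain ⟨u, s, hu⟩ := h
  obtain ⟨v, t, hv⟩ := h'
  refine ⟨((a, v + u), t + s), u, s, hu, ?_⟩
  simpa only [add_sub_cancel_right] using hv

variable {X : Type*} [NormedAddCommGroup X] [NormedSpace ℝ X]

/-- The epigraph of `(x, u) ↦ f* (u, x)`, where `f*` is the Fenchel conjugate of the function `f`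
with epigraph `E` and `x` is identified with its image in the bidual. -/
def conjEpi (E : Set ((X × StrongDual ℝ X) × ℝ)) : Set ((X × StrongDual ℝ X) × ℝ) :=
  {p | ∀ q ∈ E, p.1.2 q.1.1 + q.1.2 p.1.1 - q.2 ≤ p.2}

variable {E E' : Set ((X × StrongDual ℝ X) × ℝ)}

theorem convex_conjEpi (E : Set ((X × StrongDual ℝ X) × ℝ)) : Convex ℝ (conjEpi E) := by
  intro p hp q hq a b ha hb hab e he
  have h₁ := mul_le_mul_of_nonneg_left (hp e he) ha
  have h₂ := mul_le_mul_of_nonneg_left (hq e he) hb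
  obtain rfl : b = 1 - a := by linarith
  simp only [Prod.fst_add, Prod.snd_add, Prod.smul_fst, Prod.smul_snd, smul_eq_mul, map_add,
    map_smul, add_apply, smul_apply]
  linarith

theorem mem_conjEpi_of_le {p : X × StrongDual ℝ X} {r s : ℝ} (h : (p, r) ∈ conjEpi E)
    (hrs : r ≤ s) : (p, s) ∈ conjEpi E :=
  fun q hq => (h q hq).trans hrs

theorem conjEpi_anti (h : E ⊆ E') : conjEpi E' ⊆ conjEpi E := fun _ hp q hq => hp q (h hq)

theorem subset_conjEpi_conjEpi (E : Set ((X × StrongDual ℝ X) × ℝ)) :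
    E ⊆ conjEpi (conjEpi E) := by
  intro p hp q hq
  linarith [hq p hp]

theorem conjEpi_conjEpi_conjEpi (E : Set ((X × StrongDual ℝ X) × ℝ)) :
    conjEpi (conjEpi (conjEpi E)) = conjEpi E :=
  (conjEpi_anti (subset_conjEpi_conjEpi E)).antisymm (subset_conjEpi_conjEpi _)

theorem exists_eq_apply_add_apply (hX : IsReflexiveSpace X)
    (L : StrongDual ℝ (X × StrongDual ℝ X)) :
    ∃ (f : StrongDual ℝ X) (y : X), ∀ w α, L (w, α) = f w + α y := by
  obtain ⟨y, hy⟩ := hX (L.comp (.inr ℝ X _))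
  refine ⟨L.comp (.inl ℝ X _), y, fun w α => ?_⟩
  have hα : α y = L (0, α) := DFunLike.congr_fun hy α
  rw [hα, ContinuousLinearMap.comp_apply, ContinuousLinearMap.inl_apply, ← map_add]
  simp

theorem conjEpi_conjEpi_eq (hX : IsReflexiveSpace X) (hE : Convex ℝ E) (hcl : IsClosed E)
    (hup : ∀ ⦃p r s⦄, (p, r) ∈ E → r ≤ s → (p, s) ∈ E) (hne : (conjEpi E).Nonempty) :
    conjEpi (conjEpi E) = E := by
  refine Set.Subset.antisymm ?_ (subset_conjEpi_conjEpi E)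
  rintro ⟨⟨x, u⟩, r⟩ hmem
  by_contra hnot
  obtain ⟨⟨⟨y₀, f₀⟩, c₀⟩, h₀⟩ := hne
  obtain ⟨L, c, hminorant, hlt⟩ := exists_affine_minorant_of_notMem hE hcl hup
    (f₀ := f₀.coprod (NormedSpace.inclusionInDoubleDual ℝ X y₀)) (c₀ := -c₀)
    (fun ⟨w, α⟩ ρ h => by
      have := h₀ _ h
      simp only [ContinuousLinearMap.coprod_apply, NormedSpace.dual_def]
      linarith) hnot
  obtain ⟨f, y, hL⟩ := exists_eq_apply_add_apply hX L
  rw [hL] at hlt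
  have hconj : ((y, f), -c) ∈ conjEpi E := by
    rintro ⟨⟨w, α⟩, ρ⟩ h
    have := hminorant _ _ h
    rw [hL] at this
    simpa using by linarith
  have := hmem _ hconj
  simp only at this
  linarith

end Conjugates

section Qualification

variable {X : Type*} [NormedAddCommGroup X] [NormedSpace ℝ X]

theorem exists_forall_norm_le_and_eqOn [CompleteSpace X] {D : Set X} (hD : 0 ∈ sqri D)
    {ι : Type*} (u : ι → StrongDual ℝ X) (hu : ∀ d ∈ D, BddAbove (Set.range fun i => u i d)) :
    ∃ (v : ι → StrongDual ℝ X) (K : ℝ), (∀ i, ‖v i‖ ≤ K) ∧ ∀ i, Set.EqOn (v i) (u i) D := by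
  obtain ⟨-, Y, hY, hDY, hcone⟩ := zero_mem_sqri_iff.1 hD
  have hbdd : ∀ y ∈ Y, ∃ M, ∀ i, u i y ≤ M := fun y hy => by
    obtain ⟨t, ht, d, hd, rfl⟩ := hcone y hy
    obtain ⟨M, hM⟩ := hu d hd
    refine ⟨t * M, fun i => ?_⟩
    rw [map_smul, smul_eq_mul]
    exact mul_le_mul_of_nonneg_left (hM ⟨i, rfl⟩) ht
  have : CompleteSpace Y := hY.completeSpace_coe
  obtain ⟨K, hK⟩ := banach_steinhaus (g := fun i => (u i).comp Y.subtypeL) fun y => by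
    obtain ⟨M₁, h₁⟩ := hbdd y y.2
    obtain ⟨M₂, h₂⟩ := hbdd (-y) (Y.neg_mem y.2)
    exact ⟨max M₁ M₂, fun i => abs_le'.2
      ⟨le_max_of_le_left (h₁ i), le_max_of_le_right (by simpa using h₂ i)⟩⟩
  choose v hv hnorm using fun i => exists_extension_norm_eq Y ((u i).comp Y.subtypeL)
  exact ⟨v, K, fun i => (hnorm i).trans_le (hK i), fun i d hd => hv i ⟨d, hDY hd⟩⟩

theorem exists_tendsto_apply_ultrafilter {ι : Type*} (l : Ultrafilter ι)
    (v : ι → StrongDual ℝ X) {B : ℝ} (hv : ∀ i, ‖v i‖ ≤ B) :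
    ∃ v₀ : StrongDual ℝ X, ∀ w, Tendsto (fun i => v i w) l (𝓝 (v₀ w)) := by
  obtain ⟨v₀, -, h₀⟩ := (WeakDual.isCompact_closedBall (𝕜 := ℝ) (E := X) 0 B).ultrafilter_le_nhds
    (l.map fun i => StrongDual.toWeakDual (v i))
    (le_principal_iff.2 <| Filter.mem_map.2 <| univ_mem' fun i => by simpa using hv i)
  exact ⟨WeakDual.toStrongDual v₀, fun w => ((WeakDual.eval_continuous w).tendsto v₀).comp h₀⟩

variable {A B : Set ((X × StrongDual ℝ X) × ℝ)}

theorem mem_epiInfConv_conjEpi_iff (hA : A.Nonempty) (hB : B.Nonempty) {x y : X}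
    {ξ : StrongDual ℝ X} {r : ℝ} :
    ((x, y, ξ), r) ∈ epiInfConv (conjEpi A) (conjEpi B) ↔ ∃ u : StrongDual ℝ X,
      ∀ a ∈ A, ∀ b ∈ B,
        (u a.1.1 + a.1.2 x - a.2) + ((ξ - u) b.1.1 + b.1.2 y - b.2) ≤ r := by
  constructor
  · rintro ⟨u, s, hu, hv⟩
    exact ⟨u, fun a ha b hb => by linarith [hu a ha, hv b hb]⟩
  · rintro ⟨u, h⟩
    obtain ⟨s, hs, hrs⟩ := exists_forall_le_and_forall_le_sub
      (hA.image fun a => u a.1.1 + a.1.2 x - a.2)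
      (hB.image fun b => (ξ - u) b.1.1 + b.1.2 y - b.2) (t := r) <| by
        rintro _ ⟨a, ha, rfl⟩ _ ⟨b, hb, rfl⟩
        exact h a ha b hb
    exact ⟨u, s, fun a ha => hs _ ⟨a, ha, rfl⟩, fun b hb => hrs _ ⟨b, hb, rfl⟩⟩

theorem nonempty_of_mem_epiDom {A B : Type*} {E : Set ((A × B) × ℝ)} {a : A}
    (h : a ∈ epiDom E) : E.Nonempty :=
  let ⟨b, r, hb⟩ := h
  ⟨((a, b), r), hb⟩

theorem isClosed_epiInfConv_conjEpi [CompleteSpace X] (h : 0 ∈ sqri (epiDom A - epiDom B)) :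
    IsClosed (epiInfConv (conjEpi A) (conjEpi B)) := by
  obtain ⟨p, hpA, q, hqB, -⟩ := sqri_subset _ h
  have hA := nonempty_of_mem_epiDom hpA
  have hB := nonempty_of_mem_epiDom hqB
  refine IsSeqClosed.isClosed fun z ⟨⟨x₀, y₀, ξ₀⟩, r₀⟩ hz hlim => ?_
  choose u hu using fun n => (mem_epiInfConv_conjEpi_iff hA hB).1 (hz n)
  have hx : ∀ f : StrongDual ℝ X, Tendsto (fun n => f (z n).1.1) atTop (𝓝 (f x₀)) := fun f =>
    (f.continuous.tendsto x₀).comp hlim.fst_nhds.fst_nhds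
  have hy : ∀ f : StrongDual ℝ X, Tendsto (fun n => f (z n).1.2.1) atTop (𝓝 (f y₀)) := fun f =>
    (f.continuous.tendsto y₀).comp hlim.fst_nhds.snd_nhds.fst_nhds
  have hξ : ∀ w, Tendsto (fun n => (z n).1.2.2 w) atTop (𝓝 (ξ₀ w)) := fun w =>
    ((by fun_prop : Continuous fun ξ : StrongDual ℝ X => ξ w).tendsto ξ₀).comp
      hlim.fst_nhds.snd_nhds.snd_nhds
  have hr : Tendsto (fun n => (z n).2) atTop (𝓝 r₀) := hlim.snd_nhds
  -- Membership of `z n` only involves the values of `u n` on `epiDom A - epiDom B`, so the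
  -- possibly unbounded `u n` can be traded for the bounded `v n`.
  obtain ⟨v, K, hvK, hvu⟩ := exists_forall_norm_le_and_eqOn h u <| by
    rintro _ ⟨p, ⟨p', κ, hp⟩, q, ⟨q', κ', hq⟩, rfl⟩
    obtain ⟨M, hM⟩ := (((hr.sub (hξ q)).sub (hx p')).sub (hy q')).bddAbove_range
    refine ⟨M + κ + κ', ?_⟩
    rintro _ ⟨n, rfl⟩
    have hn := hu n _ hp _ hq
    have hMn := hM ⟨n, rfl⟩
    simp only [sub_apply, map_sub] at hn hMn ⊢
    linarith
  let l := Ultrafilter.of (atTop : Filter ℕ)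
  have hl : (l : Filter ℕ) ≤ atTop := Ultrafilter.of_le atTop
  obtain ⟨v₀, hv₀⟩ := exists_tendsto_apply_ultrafilter l v hvK
  refine (mem_epiInfConv_conjEpi_iff hA hB).2 ⟨v₀, fun a ha b hb => ?_⟩
  have hlim_a := ((hv₀ a.1.1).add ((hx a.1.2).mono_left hl)).sub_const a.2
  have hlim_b := ((((hξ b.1.1).mono_left hl).sub (hv₀ b.1.1)).add
    ((hy b.1.2).mono_left hl)).sub_const b.2
  refine le_of_tendsto_of_tendsto' (hlim_a.add hlim_b) (hr.mono_left hl) fun n => ?_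
  have hab := hvu n ⟨_, ⟨_, _, ha⟩, _, ⟨_, _, hb⟩, rfl⟩
  have hn := hu n a ha b hb
  simp only [sub_apply, map_sub] at hab hn
  linarith

theorem conjEpi_epiInfConvSnd_subset [CompleteSpace X] (hX : IsReflexiveSpace X)
    (hA : conjEpi (conjEpi A) = A) (hB : conjEpi (conjEpi B) = B) (hA' : (conjEpi A).Nonempty)
    (hB' : (conjEpi B).Nonempty) (h : 0 ∈ sqri (epiDom A - epiDom B)) :
    conjEpi (epiInfConvSnd A B) ⊆ epiInfConvSnd (conjEpi A) (conjEpi B) := by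
  have hcl := isClosed_epiInfConv_conjEpi h
  have hconv := convex_epiInfConv (convex_conjEpi A) (convex_conjEpi B)
  obtain ⟨p, ⟨p', κ, hp⟩, q, ⟨q', κ', hq⟩, hpq⟩ := sqri_subset _ h
  obtain rfl : p = q := sub_eq_zero.1 hpq
  rintro ⟨⟨x, x'⟩, r⟩ hr
  by_contra hnot
  obtain ⟨L, c, hminorant, hlt⟩ := exists_affine_minorant_of_notMem hconv hcl
    (fun _ _ _ ⟨u, s, hu, hv⟩ hrs => ⟨u, s, hu, mem_conjEpi_of_le hv (by gcongr)⟩)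
    (f₀ := p'.coprod (q'.coprod (NormedSpace.inclusionInDoubleDual ℝ X p))) (c₀ := -(κ + κ'))
    (fun ⟨y, z, ξ⟩ ρ ⟨u, s, hu, hv⟩ => by
      have := hu _ hp
      have := hv _ hq
      simp only [ContinuousLinearMap.coprod_apply, NormedSpace.dual_def, sub_apply] at *
      linarith) hnot
  obtain ⟨β, w, hβw⟩ := exists_eq_apply_add_apply hX (L.comp (.inr ℝ X _))
  set α : StrongDual ℝ X := L.comp (.inl ℝ X _) with hα
  have hL : ∀ y z ξ, L (y, z, ξ) = α y + (β z + ξ w) := fun y z ξ => by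
    rw [← hβw, hα, ContinuousLinearMap.comp_apply, ContinuousLinearMap.comp_apply, ← map_add]
    simp
  have hmem : ((w, w, α + β), -c) ∈ epiInfConv A B := by
    rw [← hA, ← hB]
    refine (mem_epiInfConv_conjEpi_iff hA' hB').2 ⟨α, fun a ha b hb => ?_⟩
    have := hminorant (a.1.1, b.1.1, a.1.2 + b.1.2) (a.2 + b.2)
      ⟨a.1.2, a.2, ha, by simpa only [add_sub_cancel_left] using hb⟩
    rw [hL] at this
    simp only [add_sub_cancel_left, add_apply] at this ⊢
    linarith
  have := hr ((w, α + β), -c) hmem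
  rw [hL] at hlt
  simp only [add_apply] at this
  linarith

end Qualification

section FenchelYoung

theorem half_norm_sq_le_of_forall_le {V : Type*} [NormedAddCommGroup V] [NormedSpace ℝ V]
    {f : StrongDual ℝ V} {K : ℝ} (h : ∀ w, f w ≤ ‖w‖ ^ 2 / 2 + K) : ‖f‖ ^ 2 / 2 ≤ K := by
  have hK : 0 ≤ K := by simpa using h 0
  have hsq : ∀ w, f w ^ 2 ≤ 2 * K * ‖w‖ ^ 2 := fun w => by
    have := discrim_le_zero (a := ‖w‖ ^ 2 / 2) (b := -f w) (c := K) fun t => by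
      have := h (t • w)
      rw [map_smul, smul_eq_mul, norm_smul, mul_pow, Real.norm_eq_abs, sq_abs] at this
      linarith
    rw [discrim] at this
    linarith
  have hnorm : ‖f‖ ≤ √(2 * K) := f.opNorm_le_bound (Real.sqrt_nonneg _) fun w => by
    rw [← Real.sqrt_sq (norm_nonneg w), ← Real.sqrt_mul (by positivity)]
    exact Real.abs_le_sqrt (hsq w)
  linarith [(Real.le_sqrt (norm_nonneg f) (by positivity)).1 hnorm]

theorem convexOn_norm_sub_sq {V : Type*} [NormedAddCommGroup V] [NormedSpace ℝ V] (v : V) :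
    ConvexOn ℝ Set.univ fun w => ‖w - v‖ ^ 2 := by
  have := (convexOn_univ_dist v).pow (fun _ _ => dist_nonneg) 2
  simp only [dist_eq_norm] at this
  exact this

variable {X : Type*} [NormedAddCommGroup X] [NormedSpace ℝ X]

theorem half_norm_sq_add_half_norm_sq_le_of_forall_le {f : StrongDual ℝ X} {y : X} {K : ℝ}
    (h : ∀ (w : X) (α : StrongDual ℝ X), f w + α y ≤ ‖w‖ ^ 2 / 2 + ‖α‖ ^ 2 / 2 + K) :
    ‖y‖ ^ 2 / 2 + ‖f‖ ^ 2 / 2 ≤ K := by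
  have hf : ∀ α : StrongDual ℝ X, ‖f‖ ^ 2 / 2 ≤ ‖α‖ ^ 2 / 2 + K - α y := fun α =>
    half_norm_sq_le_of_forall_le fun w => by linarith [h w α]
  have hy := half_norm_sq_le_of_forall_le (f := NormedSpace.inclusionInDoubleDual ℝ X y)
    (K := K - ‖f‖ ^ 2 / 2) fun α => by
      rw [NormedSpace.dual_def]
      linarith [hf α]
  rw [show ‖NormedSpace.inclusionInDoubleDual ℝ X y‖ = ‖y‖ from
    (NormedSpace.inclusionInDoubleDualLi ℝ).norm_map y] at hy
  linarith

/-- The gap in the Fenchel-Young inequality `-u x ≤ ‖x‖ ^ 2 / 2 + ‖u‖ ^ 2 / 2`. -/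
noncomputable def fenchelYoungGap (x : X) (u : StrongDual ℝ X) : ℝ :=
  u x + ‖x‖ ^ 2 / 2 + ‖u‖ ^ 2 / 2

theorem fenchelYoungGap_nonneg (x : X) (u : StrongDual ℝ X) : 0 ≤ fenchelYoungGap x u := by
  have := (abs_le.1 (u.le_opNorm x)).1
  rw [fenchelYoungGap]
  nlinarith [sq_nonneg (‖u‖ - ‖x‖)]

theorem concaveOn_apply_sub_fenchelYoungGap (z : X) (z' : StrongDual ℝ X) :
    ConcaveOn ℝ Set.univ fun p : X × StrongDual ℝ X =>
      p.2 p.1 - fenchelYoungGap (p.1 - z) (p.2 - z') := by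
  have haffine : ConcaveOn ℝ Set.univ fun p : X × StrongDual ℝ X => z' p.1 + p.2 z :=
    (z'.coprod (NormedSpace.inclusionInDoubleDual ℝ X z)).toLinearMap.concaveOn convex_univ
  have hnorm := ((convexOn_norm_sub_sq z).comp_linearMap (.fst ℝ X (StrongDual ℝ X))).add
    ((convexOn_norm_sub_sq z').comp_linearMap (.snd ℝ X (StrongDual ℝ X)))
  refine ((haffine.sub (hnorm.smul (by norm_num : (0 : ℝ) ≤ 1 / 2))).add_const (-z' z)).congr
    fun p _ => ?_
  simp only [fenchelYoungGap, Pi.sub_apply, Pi.add_apply, Function.comp_apply,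
    LinearMap.fst_apply, LinearMap.snd_apply, smul_eq_mul, sub_apply, map_sub]
  ring

theorem exists_mem_conjEpi_apply_sub_fenchelYoungGap (hX : IsReflexiveSpace X)
    {H : Set ((X × StrongDual ℝ X) × ℝ)} (hH : Convex ℝ H) (hne : H.Nonempty)
    (hle : ∀ w α ρ, ((w, α), ρ) ∈ H → α w ≤ ρ) (z : X) (z' : StrongDual ℝ X) :
    ∃ x u, ((x, u), u x - fenchelYoungGap (x - z) (u - z')) ∈ conjEpi H := by
  obtain ⟨L, c, hgL, hLH⟩ := exists_affine_between_of_concaveOn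
    (concaveOn_apply_sub_fenchelYoungGap z z')
    (by unfold fenchelYoungGap; fun_prop) hH hne fun p ρ hp =>
      (sub_le_self _ (fenchelYoungGap_nonneg _ _)).trans (hle _ _ _ hp)
  obtain ⟨f, y, hL⟩ := exists_eq_apply_add_apply hX L
  have hdual : ‖z - y‖ ^ 2 / 2 + ‖z' - f‖ ^ 2 / 2 ≤ f z + z' y + c - z' z :=
    half_norm_sq_add_half_norm_sq_le_of_forall_le fun w α => by
      have := hgL (z + w, z' + α)
      rw [hL] at this
      simp only [fenchelYoungGap, add_sub_cancel_left, add_apply, sub_apply, map_add] at this ⊢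
      rw [map_sub]
      linarith
  refine ⟨y, f, fun p hp => ?_⟩
  have := hLH p.1 p.2 hp
  rw [hL p.1.1 p.1.2] at this
  rw [norm_sub_rev, norm_sub_rev z'] at hdual
  simp only [fenchelYoungGap, sub_apply, map_sub]
  linarith

end FenchelYoung

section MonotoneOperators

variable {X : Type*} [NormedAddCommGroup X] [NormedSpace ℝ X] {S T : X → Set (StrongDual ℝ X)}

/-- The graph of the coupling function `(x, u) ↦ u x`, restricted to the graph of `T`. -/
def couplingGraph (T : X → Set (StrongDual ℝ X)) : Set ((X × StrongDual ℝ X) × ℝ) :=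
  {p | ∃ x, ∃ u ∈ T x, p = ((x, u), u x)}

/-- The epigraph of the Fitzpatrick function of `T`. -/
def fitzEpi (T : X → Set (StrongDual ℝ X)) : Set ((X × StrongDual ℝ X) × ℝ) :=
  conjEpi (couplingGraph T)

theorem opDom_subset_epiDom_couplingGraph (T : X → Set (StrongDual ℝ X)) :
    opDom T ⊆ epiDom (couplingGraph T) :=
  fun x ⟨u, hu⟩ => ⟨u, u x, x, u, hu, rfl⟩

theorem mem_fitzEpi_iff {x : X} {u : StrongDual ℝ X} {r : ℝ} :
    ((x, u), r) ∈ fitzEpi T ↔ ∀ a, ∀ a' ∈ T a, u x - r ≤ (u - a') (x - a) := by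
  have hexpand : ∀ a (a' : StrongDual ℝ X),
      u a + a' x - a' a ≤ r ↔ u x - r ≤ (u - a') (x - a) := fun a a' => by
    simp only [sub_apply, map_sub]
    constructor <;> intro h <;> linarith
  simp only [← hexpand]
  constructor
  · exact fun h a a' ha => h _ ⟨a, a', ha, rfl⟩
  · rintro h _ ⟨a, a', ha, rfl⟩
    exact h a a' ha

theorem conjEpi_conjEpi_fitzEpi (T : X → Set (StrongDual ℝ X)) :
    conjEpi (conjEpi (fitzEpi T)) = fitzEpi T :=
  conjEpi_conjEpi_conjEpi _

theorem couplingGraph_subset_conjEpi_fitzEpi (T : X → Set (StrongDual ℝ X)) :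
    couplingGraph T ⊆ conjEpi (fitzEpi T) :=
  subset_conjEpi_conjEpi _

theorem epiDom_fitzEpi_translate (T : X → Set (StrongDual ℝ X)) (w : X) :
    epiDom (fitzEpi fun x => T (x - w)) = (· + w) '' epiDom (fitzEpi T) := by
  ext x
  rw [Set.image_add_right, Set.mem_preimage, ← sub_eq_add_neg]
  refine exists_congr fun u => ?_
  constructor
  · rintro ⟨r, h⟩
    refine ⟨r - u w, mem_fitzEpi_iff.2 fun a a' ha => ?_⟩
    have := mem_fitzEpi_iff.1 h (a + w) a' (by rwa [add_sub_cancel_right])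
    simp only [map_sub, map_add, sub_apply] at this ⊢
    linarith
  · rintro ⟨r, h⟩
    refine ⟨r + u w, mem_fitzEpi_iff.2 fun a a' ha => ?_⟩
    have := mem_fitzEpi_iff.1 h (a - w) a' ha
    simp only [map_sub, sub_apply] at this ⊢
    linarith

theorem IsMonotoneOp.couplingGraph_subset_fitzEpi (hT : IsMonotoneOp T) :
    couplingGraph T ⊆ fitzEpi T := by
  rintro _ ⟨x, u, hu, rfl⟩
  refine mem_fitzEpi_iff.2 fun a a' ha => ?_
  rw [sub_self]
  exact hT a x a' ha u hu

theorem IsMonotoneOp.conjEpi_fitzEpi_subset (hT : IsMonotoneOp T) :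
    conjEpi (fitzEpi T) ⊆ fitzEpi T :=
  conjEpi_anti hT.couplingGraph_subset_fitzEpi

theorem IsMonotoneOp.add (hS : IsMonotoneOp S) (hT : IsMonotoneOp T) : IsMonotoneOp (S + T) := by
  rintro x y _ ⟨u, hu, v, hv, rfl⟩ _ ⟨u', hu', v', hv', rfl⟩
  rw [add_sub_add_comm]
  exact add_nonneg (hS x y u hu u' hu') (hT x y v hv v' hv')

theorem isMaximalMonotoneOp_of_forall_exists_fenchelYoungGap_nonpos (hT : IsMonotoneOp T)
    (h : ∀ z z', ∃ x, ∃ u ∈ T x, fenchelYoungGap (x - z) (u - z') ≤ 0) :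
    IsMaximalMonotoneOp T := by
  refine ⟨hT, fun R hR hTR => funext fun z => Set.Subset.antisymm (fun z' hz => ?_) (hTR z)⟩
  obtain ⟨x, u, hu, hgap⟩ := h z z'
  have hmono := hR z x z' hz u (hTR x hu)
  rw [fenchelYoungGap] at hgap
  have hx : ‖x - z‖ ^ 2 = 0 := by nlinarith [sq_nonneg ‖x - z‖, sq_nonneg ‖u - z'‖]
  have hu' : ‖u - z'‖ ^ 2 = 0 := by nlinarith [sq_nonneg ‖x - z‖, sq_nonneg ‖u - z'‖]
  rw [sq_eq_zero_iff, norm_eq_zero, sub_eq_zero] at hx hu'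
  rwa [← hx, ← hu']

namespace IsMaximalMonotoneOp

theorem mem_of_related (hT : IsMaximalMonotoneOp T) {x : X} {u : StrongDual ℝ X}
    (h : ∀ a, ∀ a' ∈ T a, 0 ≤ (u - a') (x - a)) : u ∈ T x := by
  have hmono : IsMonotoneOp fun a => T a ∪ {v | a = x ∧ v = u} := by
    rintro a b a' (ha | ⟨rfl, rfl⟩) b' (hb | ⟨rfl, rfl⟩)
    · exact hT.1 a b a' ha b' hb
    · exact h a a' ha
    · rw [← neg_sub a, ← neg_sub a', map_neg, neg_apply, neg_neg]
      exact h b b' hb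
    · simp
  rw [← congrFun (hT.2 _ hmono fun a => Set.subset_union_left) x]
  exact Or.inr ⟨rfl, rfl⟩

theorem nonempty_couplingGraph (hT : IsMaximalMonotoneOp T) : (couplingGraph T).Nonempty := by
  by_contra hempty
  have hno : ∀ a, ∀ a' ∈ T a, False := fun a a' ha => hempty ⟨_, a, a', ha, rfl⟩
  exact hno 0 0 (hT.mem_of_related fun a a' ha => (hno a a' ha).elim)

theorem mem_of_mem_fitzEpi_of_le (hT : IsMaximalMonotoneOp T) {x : X} {u : StrongDual ℝ X}
    {r : ℝ} (h : ((x, u), r) ∈ fitzEpi T) (hr : r ≤ u x) : u ∈ T x :=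
  hT.mem_of_related fun a a' ha => (sub_nonneg.2 hr).trans (mem_fitzEpi_iff.1 h a a' ha)

theorem apply_le_of_mem_fitzEpi (hT : IsMaximalMonotoneOp T) {x : X} {u : StrongDual ℝ X}
    {r : ℝ} (h : ((x, u), r) ∈ fitzEpi T) : u x ≤ r := by
  by_contra! hr
  have := mem_fitzEpi_iff.1 h x u (hT.mem_of_mem_fitzEpi_of_le h hr.le)
  simp only [sub_self, map_zero] at this
  linarith

theorem add_mem_of_annihilator (hT : IsMaximalMonotoneOp T) {η : StrongDual ℝ X}
    (hη : ∀ a ∈ opDom T, ∀ b ∈ opDom T, η (a - b) = 0) {x : X} {u : StrongDual ℝ X}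
    (hu : u ∈ T x) : u + η ∈ T x := by
  refine hT.mem_of_related fun a a' ha => ?_
  rw [add_sub_right_comm, add_apply, hη x ⟨u, hu⟩ a ⟨a', ha⟩, add_zero]
  exact hT.1 a x a' ha u hu

theorem sub_mem_of_mem_epiDom_fitzEpi (hT : IsMaximalMonotoneOp T) {Y : Submodule ℝ X}
    (hY : IsClosed (Y : Set X)) (hdom : ∀ a ∈ opDom T, ∀ b ∈ opDom T, a - b ∈ Y) {x b : X}
    (hx : x ∈ epiDom (fitzEpi T)) (hb : b ∈ opDom T) : x - b ∈ Y := by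
  by_contra hnot
  obtain ⟨η, hη, hηx⟩ := exists_annihilator_apply_ne_zero hY hnot
  obtain ⟨u, r, hur⟩ := hx
  obtain ⟨b', hb'⟩ := hb
  -- Along the line `b' + k • η` in `T b`, the Fitzpatrick inequality is affine in `k`.
  have hline : ∀ k : ℝ, u x - r ≤ (u - b') (x - b) - k * η (x - b) := fun k => by
    have hk := hT.add_mem_of_annihilator (η := k • η)
      (fun c hc d hd => by rw [smul_apply, hη _ (hdom c hc d hd), smul_zero]) hb'
    have := mem_fitzEpi_iff.1 hur b _ hk
    rwa [← sub_sub, sub_apply, smul_apply, smul_eq_mul] at this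
  have := hline (((u - b') (x - b) - u x + r + 1) / η (x - b))
  rw [div_mul_cancel₀ _ hηx] at this
  linarith

theorem epiDom_fitzEpi_sub_subset (hS : IsMaximalMonotoneOp S) (hT : IsMaximalMonotoneOp T)
    {Y : Submodule ℝ X} (hY : IsClosed (Y : Set X)) (hsub : opDom S - opDom T ⊆ Y) :
    epiDom (fitzEpi S) - epiDom (fitzEpi T) ⊆ Y := by
  rintro _ ⟨p, hp, q, hq, rfl⟩
  obtain ⟨_, a, a', ha', -⟩ := hS.nonempty_couplingGraph
  obtain ⟨_, b, b', hb', -⟩ := hT.nonempty_couplingGraph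
  have ha : a ∈ opDom S := ⟨a', ha'⟩
  have hb : b ∈ opDom T := ⟨b', hb'⟩
  have hpa : p - a ∈ Y := hS.sub_mem_of_mem_epiDom_fitzEpi hY (fun c hc d hd => by
    rw [← sub_sub_sub_cancel_right c d b]
    exact Y.sub_mem (hsub ⟨c, hc, b, hb, rfl⟩) (hsub ⟨d, hd, b, hb, rfl⟩)) hp ha
  have hqb : q - b ∈ Y := hT.sub_mem_of_mem_epiDom_fitzEpi hY (fun c hc d hd => by
    rw [← sub_sub_sub_cancel_left d c a]
    exact Y.sub_mem (hsub ⟨a, ha, d, hd, rfl⟩) (hsub ⟨a, ha, c, hc, rfl⟩)) hq hb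
  have hpq : p - q = p - a - (q - b) + (a - b) := by abel
  simp only [hpq]
  exact Y.add_mem (Y.sub_mem hpa hqb) (hsub ⟨a, ha, b, hb, rfl⟩)

theorem translate (hT : IsMaximalMonotoneOp T) (w : X) :
    IsMaximalMonotoneOp fun x => T (x - w) := by
  refine ⟨fun x y u hu v hv => ?_, fun R hR hTR => ?_⟩
  · rw [← sub_sub_sub_cancel_right y x w]
    exact hT.1 _ _ u hu v hv
  · have hRT := hT.2 (fun x => R (x + w))
      (fun x y u hu v hv => by
        rw [← add_sub_add_right_eq_sub y x w]
        exact hR _ _ u hu v hv)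
      (fun x => by simpa only [add_sub_cancel_right] using hTR (x + w))
    funext x
    simpa only [sub_add_cancel] using congrFun hRT (x - w)

theorem exists_mem_add_fenchelYoungGap_nonpos [CompleteSpace X] (hX : IsReflexiveSpace X)
    (hS : IsMaximalMonotoneOp S) (hT : IsMaximalMonotoneOp T)
    (h : 0 ∈ sqri (epiDom (fitzEpi S) - epiDom (fitzEpi T))) (z : X) (z' : StrongDual ℝ X) :
    ∃ x, ∃ u ∈ (S + T) x, fenchelYoungGap (x - z) (u - z') ≤ 0 := by
  obtain ⟨p, hp, q, hq, hpq⟩ := sqri_subset _ h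
  obtain rfl : p = q := sub_eq_zero.1 hpq
  obtain ⟨x, u, hxu⟩ := exists_mem_conjEpi_apply_sub_fenchelYoungGap hX
    (convex_epiInfConvSnd (convex_conjEpi (couplingGraph S)) (convex_conjEpi (couplingGraph T)))
    (epiInfConvSnd_nonempty hp hq)
    (fun w α ρ ⟨v, s, hv, hv'⟩ => by
      have := hS.apply_le_of_mem_fitzEpi hv
      have := hT.apply_le_of_mem_fitzEpi hv'
      simp only [sub_apply] at this
      linarith) z z'
  obtain ⟨v, s, hv, hv'⟩ := conjEpi_epiInfConvSnd_subset hX (conjEpi_conjEpi_fitzEpi S)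
    (conjEpi_conjEpi_fitzEpi T)
    (hS.nonempty_couplingGraph.mono (couplingGraph_subset_conjEpi_fitzEpi S))
    (hT.nonempty_couplingGraph.mono (couplingGraph_subset_conjEpi_fitzEpi T)) h hxu
  replace hv := hS.1.conjEpi_fitzEpi_subset hv
  replace hv' := hT.1.conjEpi_fitzEpi_subset hv'
  have hle := hS.apply_le_of_mem_fitzEpi hv
  have hle' := hT.apply_le_of_mem_fitzEpi hv'
  have hgap := fenchelYoungGap_nonneg (x - z) (u - z')
  simp only [sub_apply] at hle'
  refine ⟨x, u, ⟨v, hS.mem_of_mem_fitzEpi_of_le hv ?_, u - v,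
    hT.mem_of_mem_fitzEpi_of_le hv' ?_, add_sub_cancel v u⟩, ?_⟩
  · linarith
  · simp only [sub_apply]
    linarith
  · linarith

theorem sqri_epiDom_fitzEpi_sub_subset [CompleteSpace X] (hX : IsReflexiveSpace X)
    (hS : IsMaximalMonotoneOp S) (hT : IsMaximalMonotoneOp T) :
    sqri (epiDom (fitzEpi S) - epiDom (fitzEpi T)) ⊆ opDom S - opDom T := by
  intro w hw
  have hsub : epiDom (fitzEpi S) - epiDom (fitzEpi fun x => T (x - w)) =
      (fun d => d - w) '' (epiDom (fitzEpi S) - epiDom (fitzEpi T)) := by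
    simp only [epiDom_fitzEpi_translate, ← Set.image2_sub, Set.image2_image_right,
      Set.image_image2, sub_sub]
  rw [← zero_mem_sqri_image_sub, ← hsub] at hw
  obtain ⟨x, _, ⟨u, hu, v, hv, -⟩, -⟩ :=
    hS.exists_mem_add_fenchelYoungGap_nonpos hX (hT.translate w) hw 0 0
  exact ⟨x, ⟨u, hu⟩, x - w, ⟨v, hv⟩, sub_sub_cancel x w⟩

theorem opDom_subset_epiDom_fitzEpi (hT : IsMaximalMonotoneOp T) :
    opDom T ⊆ epiDom (fitzEpi T) :=
  (opDom_subset_epiDom_couplingGraph T).trans (epiDom_mono hT.1.couplingGraph_subset_fitzEpi)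

theorem zero_mem_sqri_opDom_sub_iff [CompleteSpace X] (hX : IsReflexiveSpace X)
    (hS : IsMaximalMonotoneOp S) (hT : IsMaximalMonotoneOp T) {A B : Set X}
    (hA : opDom S ⊆ A) (hA' : A ⊆ epiDom (fitzEpi S)) (hB : opDom T ⊆ B)
    (hB' : B ⊆ epiDom (fitzEpi T)) :
    0 ∈ sqri (opDom S - opDom T) ↔ 0 ∈ sqri (A - B) := by
  have hspan : ∀ Y : Submodule ℝ X, IsClosed (Y : Set X) → opDom S - opDom T ⊆ Y →
      epiDom (fitzEpi S) - epiDom (fitzEpi T) ⊆ Y := fun Y hY =>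
    hS.epiDom_fitzEpi_sub_subset hT hY
  have hsub := Set.sub_subset_sub hA hB
  have hsub' := Set.sub_subset_sub hA' hB'
  refine ⟨zero_mem_sqri_of_subset hsub fun Y hY h => hsub'.trans (hspan Y hY h), fun h => ?_⟩
  have hfitz : 0 ∈ sqri (epiDom (fitzEpi S) - epiDom (fitzEpi T)) :=
    zero_mem_sqri_of_subset hsub' (fun Y hY h => hspan Y hY (hsub.trans h)) h
  exact zero_mem_sqri_of_sqri_subset
    ((convex_epiDom (convex_conjEpi _)).sub (convex_epiDom (convex_conjEpi _)))
    (hS.sqri_epiDom_fitzEpi_sub_subset hX hT) (hsub.trans hsub') hfitz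

theorem add [CompleteSpace X] (hX : IsReflexiveSpace X) (hS : IsMaximalMonotoneOp S)
    (hT : IsMaximalMonotoneOp T) (h : 0 ∈ sqri (opDom S - opDom T)) :
    IsMaximalMonotoneOp (S + T) :=
  isMaximalMonotoneOp_of_forall_exists_fenchelYoungGap_nonpos (hS.1.add hT.1) <|
    hS.exists_mem_add_fenchelYoungGap_nonpos hX hT <| (hS.zero_mem_sqri_opDom_sub_iff hX hT
      hS.opDom_subset_epiDom_fitzEpi subset_rfl hT.opDom_subset_epiDom_fitzEpi subset_rfl).1 h

end IsMaximalMonotoneOp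

end MonotoneOperators

section Epigraphs

/-- The epigraph of an extended real valued function. -/
def epigraphOf {V : Type*} (f : V → EReal) : Set (V × ℝ) := {p | f p.1 ≤ (p.2 : EReal)}

theorem epiDom_epigraphOf {A B : Type*} (f : A × B → EReal) :
    epiDom (epigraphOf f) = Prod.fst '' effDom f := by
  ext a
  constructor
  · rintro ⟨b, r, h⟩
    exact ⟨(a, b), h.trans_lt (EReal.coe_lt_top r), rfl⟩
  · rintro ⟨⟨a, b⟩, h, rfl⟩
    obtain ⟨r, hr, -⟩ := EReal.lt_iff_exists_real_btwn.1 h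
    exact ⟨b, r, hr.le⟩

theorem isClosed_epigraphOf_iff {V : Type*} [TopologicalSpace V] {f : V → EReal} :
    IsClosed (epigraphOf f) ↔ LowerSemicontinuous f := by
  refine ⟨fun h x y hxy => ?_, fun h => h.isClosed_epigraph.preimage
    (continuous_fst.prodMk (continuous_coe_real_ereal.comp continuous_snd))⟩
  obtain ⟨r, hyr, hrx⟩ := EReal.lt_iff_exists_real_btwn.1 hxy
  have hopen : IsOpen ((fun x => (x, r)) ⁻¹' (epigraphOf f)ᶜ) :=
    h.isOpen_compl.preimage (by fun_prop)
  filter_upwards [hopen.mem_nhds hrx.not_ge] with x' hx'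
  exact hyr.trans (not_le.1 hx')

variable {A B : Type*} [AddCommGroup B] {f g : A × B → EReal}

theorem mem_epiInfConvSnd_of_infConvSnd_lt (hf : ∀ p, f p ≠ ⊥) (hg : ∀ p, g p ≠ ⊥) {p : A × B}
    {r : ℝ} (h : infConvSnd f g p < r) :
    (p, r) ∈ epiInfConvSnd (epigraphOf f) (epigraphOf g) := by
  obtain ⟨c, hc⟩ := iInf_lt_iff.1 h
  have hf_top : f (p.1, c) ≠ ⊤ := fun h => by
    simp only [h, EReal.top_add_of_ne_bot (hg _), not_top_lt] at hc
  have hg_top : g (p.1, p.2 - c) ≠ ⊤ := fun h => by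
    simp only [h, EReal.add_top_of_ne_bot (hf _), not_top_lt] at hc
  lift f (p.1, c) to ℝ using ⟨hf_top, hf _⟩ with s hs
  lift g (p.1, p.2 - c) to ℝ using ⟨hg_top, hg _⟩ with t ht
  refine ⟨c, s, hs.ge, ht.symm.trans_le ?_⟩
  norm_cast at hc ⊢
  exact le_sub_iff_add_le'.2 hc.le

theorem epigraphOf_infConvSnd [TopologicalSpace A] [TopologicalSpace B] (hf : ∀ p, f p ≠ ⊥)
    (hg : ∀ p, g p ≠ ⊥) (hcl : IsClosed (epiInfConvSnd (epigraphOf f) (epigraphOf g))) :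
    epigraphOf (infConvSnd f g) = epiInfConvSnd (epigraphOf f) (epigraphOf g) := by
  ext ⟨p, r⟩
  constructor
  · intro h
    have hlim : Tendsto (fun s : ℝ => (p, s)) (𝓝[>] r) (𝓝 (p, r)) :=
      ((by fun_prop : Continuous fun s : ℝ => (p, s)).tendsto r).mono_left nhdsWithin_le_nhds
    refine hcl.mem_of_tendsto hlim (eventually_of_mem self_mem_nhdsWithin fun s hs => ?_)
    exact mem_epiInfConvSnd_of_infConvSnd_lt hf hg (h.trans_lt (EReal.coe_lt_coe_iff.2 hs))
  · rintro ⟨c, s, hc, hc'⟩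
    calc
      infConvSnd f g p ≤ f (p.1, c) + g (p.1, p.2 - c) := iInf_le _ c
      _ ≤ (s : EReal) + ((r - s : ℝ) : EReal) := add_le_add hc hc'
      _ = r := by rw [← EReal.coe_add, add_sub_cancel]

end Epigraphs

namespace IsRepresentative

variable {X : Type*} [NormedAddCommGroup X] [NormedSpace ℝ X] {S T : X → Set (StrongDual ℝ X)}
  {f g : X × StrongDual ℝ X → EReal}

theorem ne_bot (hf : IsRepresentative f T) (p : X × StrongDual ℝ X) : f p ≠ ⊥ :=
  ((EReal.bot_lt_coe _).trans_le (hf.coupling_le p.1 p.2)).ne'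

theorem couplingGraph_subset_epigraphOf (hf : IsRepresentative f T) :
    couplingGraph T ⊆ epigraphOf f := by
  rintro _ ⟨x, u, hu, rfl⟩
  exact (hf.eq_coupling x u hu).le

theorem epigraphOf_subset_fitzEpi (hf : IsRepresentative f T) : epigraphOf f ⊆ fitzEpi T := by
  rintro ⟨⟨x, u⟩, r⟩ h
  refine mem_fitzEpi_iff.2 fun a a' ha => ?_
  -- Compare `f` with the coupling along the segment from `(a, a')` to `(x, u)`, near `(a, a')`.
  have hsegment : ∀ t ∈ Set.Ioo (0 : ℝ) 1, u x - r ≤ (1 - t) * (u - a') (x - a) := by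
    rintro t ⟨ht₀, ht₁⟩
    have hconv := hf.convex (hf.couplingGraph_subset_epigraphOf ⟨a, a', ha, rfl⟩) h
      (sub_nonneg.2 ht₁.le) ht₀.le (sub_add_cancel 1 t)
    have hle := EReal.coe_le_coe_iff.1 ((hf.coupling_le _ _).trans hconv)
    refine le_of_mul_le_mul_left ?_ ht₀
    simp only [Prod.smul_mk, Prod.mk_add_mk, add_apply, sub_apply, smul_apply, map_add, map_sub,
      map_smul, smul_eq_mul] at hle ⊢
    linarith
  have hlim : Tendsto (fun t : ℝ => (1 - t) * (u - a') (x - a)) (𝓝[>] 0)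
      (𝓝 ((1 - 0) * (u - a') (x - a))) :=
    ((by fun_prop : Continuous fun t : ℝ => (1 - t) * (u - a') (x - a)).tendsto 0).mono_left
      nhdsWithin_le_nhds
  rw [sub_zero, one_mul] at hlim
  exact ge_of_tendsto hlim (eventually_of_mem (Ioo_mem_nhdsGT one_pos) hsegment)

theorem opDom_subset_fst_image_effDom (hf : IsRepresentative f T) :
    opDom T ⊆ Prod.fst '' effDom f :=
  epiDom_epigraphOf f ▸ (opDom_subset_epiDom_couplingGraph T).trans
    (epiDom_mono hf.couplingGraph_subset_epigraphOf)

theorem fst_image_effDom_subset_epiDom_fitzEpi (hf : IsRepresentative f T) :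
    Prod.fst '' effDom f ⊆ epiDom (fitzEpi T) :=
  epiDom_epigraphOf f ▸ epiDom_mono hf.epigraphOf_subset_fitzEpi

theorem couplingGraph_subset_conjEpi_epigraphOf (hf : IsRepresentative f T) :
    couplingGraph T ⊆ conjEpi (epigraphOf f) :=
  (couplingGraph_subset_conjEpi_fitzEpi T).trans (conjEpi_anti hf.epigraphOf_subset_fitzEpi)

theorem opDom_subset_epiDom_conjEpi (hf : IsRepresentative f T) :
    opDom T ⊆ epiDom (conjEpi (epigraphOf f)) :=
  (opDom_subset_epiDom_couplingGraph T).trans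
    (epiDom_mono hf.couplingGraph_subset_conjEpi_epigraphOf)

theorem epiDom_conjEpi_subset_epiDom_fitzEpi (hf : IsRepresentative f T) :
    epiDom (conjEpi (epigraphOf f)) ⊆ epiDom (fitzEpi T) :=
  epiDom_mono (conjEpi_anti hf.couplingGraph_subset_epigraphOf)

theorem conjEpi_conjEpi_epigraphOf (hX : IsReflexiveSpace X) (hT : IsMaximalMonotoneOp T)
    (hf : IsRepresentative f T) : conjEpi (conjEpi (epigraphOf f)) = epigraphOf f :=
  conjEpi_conjEpi_eq hX hf.convex (isClosed_epigraphOf_iff.2 hf.lsc)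
    (fun _ _ _ h hrs => h.trans (EReal.coe_le_coe_iff.2 hrs))
    (hT.nonempty_couplingGraph.mono hf.couplingGraph_subset_conjEpi_epigraphOf)

theorem isClosed_epiInfConv [CompleteSpace X] (hX : IsReflexiveSpace X)
    (hS : IsMaximalMonotoneOp S) (hT : IsMaximalMonotoneOp T) (hf : IsRepresentative f S)
    (hg : IsRepresentative g T) (h : 0 ∈ sqri (opDom S - opDom T)) :
    IsClosed (epiInfConv (epigraphOf f) (epigraphOf g)) := by
  rw [← hf.conjEpi_conjEpi_epigraphOf hX hS, ← hg.conjEpi_conjEpi_epigraphOf hX hT]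
  exact isClosed_epiInfConv_conjEpi <| (hS.zero_mem_sqri_opDom_sub_iff hX hT
    hf.opDom_subset_epiDom_conjEpi hf.epiDom_conjEpi_subset_epiDom_fitzEpi
    hg.opDom_subset_epiDom_conjEpi hg.epiDom_conjEpi_subset_epiDom_fitzEpi).1 h

theorem coupling_le_infConvSnd (hf : IsRepresentative f S) (hg : IsRepresentative g T) (x : X)
    (u : StrongDual ℝ X) : ((u x : ℝ) : EReal) ≤ infConvSnd f g (x, u) :=
  le_iInf fun v => calc
    ((u x : ℝ) : EReal) = (v x : ℝ) + ((u - v) x : ℝ) := by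
      rw [← EReal.coe_add, sub_apply, add_sub_cancel]
    _ ≤ f (x, v) + g (x, u - v) := add_le_add (hf.coupling_le x v) (hg.coupling_le x (u - v))

theorem infConvSnd_add [CompleteSpace X] (hX : IsReflexiveSpace X) (hS : IsMaximalMonotoneOp S)
    (hT : IsMaximalMonotoneOp T) (hf : IsRepresentative f S) (hg : IsRepresentative g T)
    (h : 0 ∈ sqri (opDom S - opDom T)) : IsRepresentative (infConvSnd f g) (S + T) := by
  have hcl : IsClosed (epiInfConvSnd (epigraphOf f) (epigraphOf g)) :=
    (hf.isClosed_epiInfConv hX hS hT hg h).preimage (by fun_prop)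
  have hepi := epigraphOf_infConvSnd hf.ne_bot hg.ne_bot hcl
  refine ⟨hS.1.add hT.1, ?_, isClosed_epigraphOf_iff.1 (hepi ▸ hcl),
    hf.coupling_le_infConvSnd hg, ?_⟩
  · change Convex ℝ (epigraphOf (infConvSnd f g))
    exact hepi ▸ convex_epiInfConvSnd hf.convex hg.convex
  · rintro x _ ⟨u, hu, v, hv, rfl⟩
    refine le_antisymm ((iInf_le _ u).trans_eq ?_) (hf.coupling_le_infConvSnd hg _ _)
    simp only [add_sub_cancel_left, hf.eq_coupling x u hu, hg.eq_coupling x v hv, add_apply,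
      EReal.coe_add]

end IsRepresentative

section Bifunctions

variable {X : Type*} {C : Set X} {F G : C → C → ℝ}

theorem IsMonotoneBif.add (hF : IsMonotoneBif F) (hG : IsMonotoneBif G) :
    IsMonotoneBif fun x y => F x y + G x y :=
  fun x y => by linarith [hF x y, hG x y]

variable [NormedAddCommGroup X] [NormedSpace ℝ X]

theorem IsMonotoneBif.isMonotoneOp_bifOp (hF : IsMonotoneBif F) (hF₀ : ∀ x, F x x = 0) :
    IsMonotoneOp (bifOp F) := by
  rintro x y u ⟨hx, hu⟩ v ⟨hy, hv⟩
  have hxy := hu ⟨y, hy⟩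
  have hyx := hv ⟨x, hx⟩
  have hmono := hF ⟨x, hx⟩ ⟨y, hy⟩
  rw [hF₀] at hxy hyx
  simp only [map_sub, sub_apply] at *
  linarith

theorem bifOp_add_subset (F G : C → C → ℝ) (x : X) :
    (bifOp F + bifOp G) x ⊆ bifOp (fun x y => F x y + G x y) x := by
  rintro _ ⟨u, ⟨hx, hu⟩, v, ⟨_, hv⟩, rfl⟩
  refine ⟨hx, fun y => ?_⟩
  rw [add_apply, add_sub_add_comm]
  exact add_le_add (hu y) (hv y)

end Bifunctions

theorem mainTheorem5 {X : Type*} [NormedAddCommGroup X] [NormedSpace ℝ X] [CompleteSpace X]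
    (hX : IsReflexiveSpace X) (C : Set X) (F G : C → C → ℝ)
    (hF0 : ∀ x : C, F x x = 0) (hG0 : ∀ x : C, G x x = 0)
    (hF : IsMaximalMonotoneBif F) (hG : IsMaximalMonotoneBif G)
    (fF fG : X × StrongDual ℝ X → EReal)
    (hfF : IsRepresentative fF (bifOp F)) (hfG : IsRepresentative fG (bifOp G)) :
    ((0 : X) ∈ sqri (opDom (bifOp F) - opDom (bifOp G)) ↔
      (0 : X) ∈ sqri (Prod.fst '' effDom fF - Prod.fst '' effDom fG)) ∧
    ((0 : X) ∈ sqri (opDom (bifOp F) - opDom (bifOp G)) →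
      IsMaximalMonotoneBif (fun x y => F x y + G x y) ∧
      (∀ x : X, bifOp F x + bifOp G x = bifOp (fun x y => F x y + G x y) x) ∧
      IsRepresentative (infConvSnd fF fG) (bifOp (fun x y => F x y + G x y))) := by 
  refine ⟨hF.2.zero_mem_sqri_opDom_sub_iff hX hG.2 hfF.opDom_subset_fst_image_effDom
    hfF.fst_image_effDom_subset_epiDom_fitzEpi hfG.opDom_subset_fst_image_effDom
    hfG.fst_image_effDom_subset_epiDom_fitzEpi, fun h => ?_⟩
  have hmax : IsMaximalMonotoneOp (bifOp F + bifOp G) := hF.2.add hX hG.2 h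
  have hmono := hF.1.add hG.1
  have heq : bifOp (fun x y => F x y + G x y) = bifOp F + bifOp G :=
    hmax.2 _ (hmono.isMonotoneOp_bifOp fun x => by rw [hF0, hG0, add_zero]) (bifOp_add_subset F G)
  rw [IsMaximalMonotoneBif, heq]
  exact ⟨⟨hmono, hmax⟩, fun _ => rfl, hfF.infConvSnd_add hX hF.2 hG.2 hfG h⟩
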